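/- Let $f$ be a monic centered complex polynomial of degree $d\ge 2$ (centered: the coefficient of $z^{d-1}$ vanishes), and let $f^n$ denote its $n$-th iterate. Let $a\in\mathbb{C}\setminus\{0\}$, $b\in\mathbb{C}$ and let $\phi$ be the affine map with $\phi^{-1}(z)=az+b$. For a polynomial map $g$ write $K_g$ for its filled Julia set, the set of points with bounded forward orbit under $g$. Let $$\mathcal{C}(\phi^{-1}\circ f^n)=\{(a',b')\in\mathbb{C}^2 \mid a'\neq 0,\ K_{a'f^n+b'}\text{ is connected}\}$$ be the connectedness locus of the $n$-th two-parameter family, and for a sequence of sets $S_n$ let $\liminf_{n\to\infty} S_n$ be the set of limits of convergent sequences $(s_n)$ with $s_n\in S_n$ for all sufficiently large $n$. Let $c$ be a critical point of $f$ and let $k\ge 0$ be an integer such that $\phi^{-1}(f^k(c))\notin K_f$. Then there is $N$ such that $\phi^{-1}(f^k(c))\notin K_{\phi^{-1}\circ f^n}$ for all $n\ge N$. If moreover $k\ge 1$, then $(a,b)\notin\liminf_{n\to\infty}\mathcal{C}(\phi^{-1}\circ f^n)$. -/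

import Mathlib

open Polynomial Filter Topology

/-- The filled Julia set of a map `g : ℂ → ℂ`: the points with bounded forward orbit. -/
def filledJulia (g : ℂ → ℂ) : Set ℂ :=
  {z | Bornology.IsBounded (Set.range fun m : ℕ => g^[m] z)}

/-- The map `φ⁻¹ ∘ fⁿ`, where `φ⁻¹(z) = a z + b` and `fⁿ` is the `n`-th iterate of `f`. -/
def affineIterate (f : ℂ[X]) (a b : ℂ) (n : ℕ) : ℂ → ℂ :=
  fun z => a * (fun w => f.eval w)^[n] z + b

/-- The connectedness locus of the two-parameter family `φ⁻¹ ∘ fⁿ`, `φ⁻¹(z) = a z + b` with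
`a ≠ 0`: the parameters whose filled Julia set is connected. -/
def connectednessLocus (f : ℂ[X]) (n : ℕ) : Set (ℂ × ℂ) :=
  {p | p.1 ≠ 0 ∧ IsConnected (filledJulia (affineIterate f p.1 p.2 n))}

/-- The lower limit of a sequence of sets: all limits of sequences `u n` with `u n ∈ S n`
for all large `n`. -/
def setLiminf {X : Type*} [TopologicalSpace X] (S : ℕ → Set X) : Set X :=
  {x | ∃ u : ℕ → X, (∀ᶠ n in atTop, u n ∈ S n) ∧ Tendsto u atTop (𝓝 x)}

/-- A polynomial of degree `d` is centered if its coefficient of `z ^ (d - 1)` vanishes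
(used for `d ≥ 2` only). -/
def IsCentered (f : ℂ[X]) : Prop :=
  f.coeff (f.natDegree - 1) = 0

/-!
Suppose that a critical point `ζ` of a polynomial `G` escapes while `K_G` is connected. Fix
`p ∈ K_G` and put `P = G^m - p` with `m` large. The zeros of `P` lie in `K_G`, on which `|P|` is
bounded by some `R < |P ζ|`. As `K_G` is connected, all quotients `(z - x) / (z - y)` with
`x, y ∈ K_G` have holomorphic logarithms on `{|P| > R}`, so `P` has there a holomorphic root `H` of
order `deg P`, which is injective near infinity. The double points of `H` form a bounded set, which
is open by Hurwitz's theorem and relatively closed by properness of `P`. Its boundary lies in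
`{|P| ≤ R}`, so the maximum principle for `P` shows that it is empty. Hence `P' ζ ≠ 0`, a
contradiction.

For `n ≥ k ≥ 1` the point `a' f^k(c) + b'` is a critical value of `a' f^n + b'`. For `(a', b')`
close to `(a, b)` its orbit under `f` leaves a disc outside which `f` at least doubles norms; for
large `n` the map `a' f^n + b'` does so too, uniformly in `(a', b')`, and the point escapes.
-/

section Dslope

variable {𝕜 E : Type*} [NontriviallyNormedField 𝕜] [NormedAddCommGroup E] [NormedSpace 𝕜 E]
  {f : 𝕜 → E} {x y : 𝕜}

lemma eq_of_dslope_eq_zero (h : dslope f x y = 0) : f y = f x := by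
  rw [← sub_eq_zero, ← sub_smul_dslope, h, smul_zero]

lemma continuousAt_uncurry_dslope_of_ne (hxy : x ≠ y)
    (hx : ContinuousAt f x) (hy : ContinuousAt f y) :
    ContinuousAt (Function.uncurry (dslope f)) (x, y) := by
  have hslope : ContinuousAt (fun p : 𝕜 × 𝕜 ↦ (p.2 - p.1)⁻¹ • (f p.2 - f p.1)) (x, y) :=
    ((continuousAt_snd.sub continuousAt_fst).inv₀ (sub_ne_zero.2 hxy.symm)).smul
      ((ContinuousAt.comp' hy continuousAt_snd).sub (ContinuousAt.comp' hx continuousAt_fst))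
  refine hslope.congr ?_
  filter_upwards [(isOpen_ne_fun continuous_fst continuous_snd).mem_nhds hxy] with p hp
  simp only [Function.uncurry_def, dslope_of_ne f (Ne.symm hp), slope_def_module]

lemma continuousAt_uncurry_dslope_same (hf : HasStrictDerivAt f (deriv f x) x)
    (hf' : ContinuousAt (deriv f) x) : ContinuousAt (Function.uncurry (dslope f)) (x, x) := by
  simp only [Metric.continuousAt_iff', Function.uncurry_apply_pair, dslope_same]
  intro ε hε
  have hderiv : ∀ᶠ p : 𝕜 × 𝕜 in 𝓝 (x, x), dist (deriv f p.1) (deriv f x) < ε :=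
    (continuous_fst.tendsto (x, x)).eventually (Metric.continuousAt_iff'.1 hf' ε hε)
  have hincr : ∀ᶠ p : 𝕜 × 𝕜 in 𝓝 (x, x),
      ‖f p.2 - f p.1 - (p.2 - p.1) • deriv f x‖ ≤ ε / 2 * ‖p.2 - p.1‖ := by
    simpa using (continuous_swap.tendsto (x, x)).eventually (hf.isLittleO.def (half_pos hε))
  filter_upwards [hderiv, hincr] with ⟨z, w⟩ hz hzw
  rcases eq_or_ne z w with rfl | hne
  · simpa only [Function.uncurry_apply_pair, dslope_same] using hz
  have hpos : 0 < ‖w - z‖ := norm_pos_iff.2 (sub_ne_zero.2 hne.symm)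
  rw [Function.uncurry_apply_pair, dist_eq_norm, ← mul_lt_mul_iff_right₀ hpos, ← norm_smul,
    smul_sub, sub_smul_dslope]
  exact hzw.trans_lt (by nlinarith)

end Dslope

lemma continuousAt_uncurry_dslope_of_differentiableOn {f : ℂ → ℂ} {s : Set ℂ} (hs : IsOpen s)
    (hf : DifferentiableOn ℂ f s) {x y : ℂ} (hx : x ∈ s) (hy : y ∈ s) :
    ContinuousAt (Function.uncurry (dslope f)) (x, y) := by
  have han : ∀ z ∈ s, AnalyticAt ℂ f z := fun z hz ↦ hf.analyticAt (hs.mem_nhds hz)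
  rcases eq_or_ne x y with rfl | hxy
  · exact continuousAt_uncurry_dslope_same (han x hx).hasStrictDerivAt (han x hx).deriv.continuousAt
  · exact continuousAt_uncurry_dslope_of_ne hxy (han x hx).continuousAt (han y hy).continuousAt

-- Otherwise `1 / F x` would violate the maximum principle on a small disc around `z₀`.
lemma eventually_exists_eq_zero {X : Type*} [TopologicalSpace X] {F : X → ℂ → ℂ} {x₀ : X} {z₀ : ℂ}
    {U : Set ℂ} (hU : U ∈ 𝓝 z₀) (hF : ∀ᶠ x in 𝓝 x₀, DifferentiableOn ℂ (F x) U)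
    (hcont : ∀ z ∈ U, ContinuousAt (Function.uncurry F) (x₀, z)) (hzero : F x₀ z₀ = 0)
    (hisol : ∀ᶠ z in 𝓝[≠] z₀, F x₀ z ≠ 0) :
    ∀ᶠ x in 𝓝 x₀, ∃ z ∈ U, F x z = 0 := by
  obtain ⟨r, hr, hball⟩ := Metric.nhds_basis_closedBall.mem_iff.1
    (inter_mem hU (eventually_nhdsWithin_iff.1 hisol))
  have hcenter_lt_sphere : ∀ᶠ x in 𝓝 x₀, ∀ z ∈ Metric.sphere z₀ r, ‖F x z₀‖ < ‖F x z‖ := by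
    refine (isCompact_sphere z₀ r).eventually_forall_of_forall_eventually fun z hz ↦ ?_
    have hzball := hball (Metric.sphere_subset_closedBall hz)
    have hcenter : ContinuousAt (fun p : X × ℂ ↦ ‖F p.1 z₀‖) (x₀, z) :=
      (ContinuousAt.comp (f := fun p : X × ℂ ↦ (p.1, z₀)) (x := (x₀, z))
        (hcont z₀ (mem_of_mem_nhds hU)) (by fun_prop)).norm
    refine hcenter.eventually_lt (hcont z hzball.1).norm ?_
    simpa [hzero] using hzball.2 (Metric.ne_of_mem_sphere hz hr.ne')
  filter_upwards [hF, hcenter_lt_sphere] with x hdiff hlt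
  by_contra! hne
  have hinv : DiffContOnCl ℂ (fun z ↦ (F x z)⁻¹) (Metric.ball z₀ r) := by
    refine DifferentiableOn.diffContOnCl ?_
    rw [closure_ball _ hr.ne']
    exact (hdiff.inv hne).mono fun z hz ↦ (hball hz).1
  obtain ⟨z, hz, hmax⟩ := Complex.exists_mem_frontier_isMaxOn_norm Metric.isBounded_ball
    (Metric.nonempty_ball.2 hr) hinv
  rw [frontier_ball _ hr.ne'] at hz
  have hle := hmax (subset_closure (Metric.mem_ball_self hr))
  simp only [Function.comp_apply, norm_inv, Set.mem_ofPred_eq] at hle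
  have h0 : 0 < ‖F x z₀‖ := norm_pos_iff.2 (hne z₀ (mem_of_mem_nhds hU))
  exact (hlt z hz).not_ge ((inv_le_inv₀ h0 (h0.trans (hlt z hz))).1 hle)

/-- The double points of `H` in `s`: the points `w ∈ s` that are not a simple and unique solution in
`s` of `H z = H w`. The divided slope `dslope H w z` is `(H z - H w) / (z - w)` for `z ≠ w` and
`H' w` for `z = w`, so that its zeros account both for `H z = H w` off the diagonal and for critical
points on it. -/
def doublePoints (H : ℂ → ℂ) (s : Set ℂ) : Set ℂ :=
  {w ∈ s | ∃ z ∈ s, dslope H w z = 0}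

lemma isOpen_doublePoints {H : ℂ → ℂ} {s : Set ℂ} (hs : IsOpen s) (hH : DifferentiableOn ℂ H s)
    (hconst : ∀ z ∈ s, ¬ ∀ᶠ z' in 𝓝 z, H z' = H z) : IsOpen (doublePoints H s) := by
  refine isOpen_iff_eventually.2 fun w ⟨hw, z, hz, hwz⟩ ↦ ?_
  have hdslope : ∀ w ∈ s, DifferentiableOn ℂ (dslope H w) s := fun w hw ↦
    (Complex.differentiableOn_dslope (hs.mem_nhds hw)).2 hH
  have hisol : ∀ᶠ z' in 𝓝[≠] z, dslope H w z' ≠ 0 := by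
    refine ((hdslope w hw).analyticAt
      (hs.mem_nhds hz)).eventually_eq_zero_or_eventually_ne_zero.resolve_left fun h ↦ hconst z hz ?_
    filter_upwards [h] with z' hz'
    rw [eq_of_dslope_eq_zero hz', eq_of_dslope_eq_zero hwz]
  filter_upwards [hs.mem_nhds hw, eventually_exists_eq_zero (hs.mem_nhds hz)
    ((hs.eventually_mem hw).mono hdslope)
    (fun z' hz' ↦ continuousAt_uncurry_dslope_of_differentiableOn hs hH hw hz') hwz hisol]
    with w' hw' hzero
  exact ⟨hw', hzero⟩

lemma closure_doublePoints_inter_subset {H : ℂ → ℂ} {s : Set ℂ} (hs : IsOpen s)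
    (hH : DifferentiableOn ℂ H s)
    (hproper : ∀ C ⊆ s, IsCompact C → ∃ D ⊆ s, IsCompact D ∧ ∀ z ∈ s, H z ∈ H '' C → z ∈ D) :
    closure (doublePoints H s) ∩ s ⊆ doublePoints H s := by
  rintro w ⟨hwcl, hw⟩
  obtain ⟨C, hC, hCs, hCcompact⟩ := local_compact_nhds (hs.mem_nhds hw)
  obtain ⟨D, hDs, hDcompact, hD⟩ := hproper C hCs hCcompact
  let Z : Set (ℂ × ℂ) := {p ∈ C ×ˢ D | Function.uncurry (dslope H) p = 0}
  have hZ : IsCompact Z := by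
    have hcont : ContinuousOn (Function.uncurry (dslope H)) (C ×ˢ D) := fun p hp ↦
      (continuousAt_uncurry_dslope_of_differentiableOn hs hH (hCs hp.1)
        (hDs hp.2)).continuousWithinAt
    have hCD := hCcompact.prod hDcompact
    exact hCD.of_isClosed_subset
      (hcont.preimage_isClosed_of_isClosed hCD.isClosed isClosed_singleton) fun p hp ↦ hp.1
  have hsub : interior C ∩ doublePoints H s ⊆ Prod.fst '' Z := by
    rintro w' ⟨hw', -, z, hz, hwz⟩
    replace hw' := interior_subset hw'
    exact ⟨(w', z), ⟨⟨hw', hD z hz ⟨w', hw', (eq_of_dslope_eq_zero hwz).symm⟩⟩, hwz⟩, rfl⟩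
  obtain ⟨⟨_, z⟩, ⟨⟨_, hz⟩, hwz⟩, rfl⟩ : w ∈ Prod.fst '' Z :=
    closure_minimal hsub (hZ.image continuous_fst).isClosed
      (isOpen_interior.inter_closure ⟨mem_interior_iff_mem_nhds.2 hC, hwcl⟩)
  exact ⟨hw, z, hDs hz, hwz⟩

lemma norm_le_of_closure_inter_subset {f : ℂ → ℂ} (hf : Differentiable ℂ f) {R : ℝ} {A : Set ℂ}
    (hA : IsOpen A) (hbdd : Bornology.IsBounded A)
    (hclosed : closure A ∩ {z | R < ‖f z‖} ⊆ A) {z : ℂ} (hz : z ∈ A) : ‖f z‖ ≤ R := by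
  refine Complex.norm_le_of_forall_mem_frontier_norm_le hbdd hf.diffContOnCl (fun w hw ↦ ?_)
    (subset_closure hz)
  by_contra! hlt
  rw [hA.frontier_eq] at hw
  exact hw.2 (hclosed ⟨hw.1, hlt⟩)

lemma injOn_nhds_of_hasStrictDerivAt {𝕜 : Type*} [NontriviallyNormedField 𝕜] [CompleteSpace 𝕜]
    {f : 𝕜 → 𝕜} {f' x : 𝕜} (hf : HasStrictDerivAt f f' x) (hf' : f' ≠ 0) :
    ∃ t ∈ 𝓝 x, Set.InjOn f t := by
  have hequiv := hf.hasStrictFDerivAt_equiv hf'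
  exact ⟨_, (hequiv.toOpenPartialHomeomorph f).open_source.mem_nhds
    hequiv.mem_toOpenPartialHomeomorph_source, (hequiv.toOpenPartialHomeomorph f).injOn⟩

-- In the coordinate `u = z⁻¹` at infinity, `1 / H` has a simple zero at `u = 0`.
lemma exists_injOn_cobounded_of_isTheta {H : ℂ → ℂ}
    (hdiff : ∀ᶠ z in Bornology.cobounded ℂ, DifferentiableAt ℂ H z)
    (hH : H =Θ[Bornology.cobounded ℂ] id) :
    ∃ t ∈ Bornology.cobounded ℂ, Set.InjOn H t := by
  let g : ℂ → ℂ := Function.update (fun u ↦ (H u⁻¹)⁻¹) 0 0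
  have hg_ne : ∀ u ≠ 0, g u = (H u⁻¹)⁻¹ := fun u hu ↦ Function.update_of_ne hu _ _
  have hg_zero : g 0 = 0 := Function.update_self ..
  have hg_isTheta : g =Θ[𝓝[≠] 0] id := by
    have hcomp : (fun u ↦ H u⁻¹) =Θ[𝓝[≠] 0] (fun u ↦ u⁻¹) :=
      ⟨hH.1.comp_tendsto tendsto_inv₀_nhdsNE_zero, hH.2.comp_tendsto tendsto_inv₀_nhdsNE_zero⟩
    exact (EventuallyEq.isTheta (eventually_mem_nhdsWithin.mono hg_ne)).trans
      (hcomp.inv.trans_eventuallyEq (.of_eq (funext inv_inv)))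
  have hg_analyticAt : AnalyticAt ℂ g 0 := by
    refine Complex.analyticAt_of_differentiable_on_punctured_nhds_of_continuousAt ?_ ?_
    · have hH_ne : ∀ᶠ z in Bornology.cobounded ℂ, H z ≠ 0 := by
        filter_upwards [hH.2.eq_zero_imp, Bornology.eventually_ne_cobounded 0] with z himp hz
          using mt himp hz
      filter_upwards [tendsto_inv₀_nhdsNE_zero.eventually (hdiff.and hH_ne),
        eventually_mem_nhdsWithin] with u ⟨hdu, hHu⟩ hu
      exact ((hdu.comp u (differentiableAt_inv hu)).inv hHu).congr_of_eventuallyEq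
        ((eventually_ne_nhds hu).mono hg_ne)
    · rw [continuousAt_iff_punctured_nhds, hg_zero]
      exact hg_isTheta.1.trans_tendsto (continuousAt_id.tendsto.mono_left nhdsWithin_le_nhds)
  have hg_deriv : deriv g 0 ≠ 0 := by
    intro h0
    have hg_isLittleO : g =o[𝓝 0] fun u ↦ u := by
      simpa [h0, hg_zero] using
        hasDerivAt_iff_isLittleO.1 hg_analyticAt.differentiableAt.hasDerivAt
    exact Asymptotics.isLittleO_irrefl
      (eventually_mem_nhdsWithin (a := (0 : ℂ)) (s := {0}ᶜ)).frequently
      (hg_isTheta.2.trans_isLittleO (hg_isLittleO.mono nhdsWithin_le_nhds))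
  obtain ⟨t, ht, hinj⟩ := injOn_nhds_of_hasStrictDerivAt hg_analyticAt.hasStrictDerivAt hg_deriv
  refine ⟨{z | z ≠ 0 ∧ z⁻¹ ∈ t}, (Bornology.eventually_ne_cobounded 0).and
    (tendsto_inv₀_cobounded.eventually ht), fun z ⟨hz0, hz⟩ w ⟨hw0, hw⟩ hzw ↦ ?_⟩
  refine inv_injective (hinj hz hw ?_)
  rw [hg_ne _ (inv_ne_zero hz0), hg_ne _ (inv_ne_zero hw0), inv_inv, inv_inv, hzw]

lemma exists_injOn_cobounded_of_pow_eq_eval {P : ℂ[X]} (hP : 0 < P.natDegree) {H : ℂ → ℂ}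
    (hdiff : ∀ᶠ z in Bornology.cobounded ℂ, DifferentiableAt ℂ H z)
    (hH : ∀ᶠ z in Bornology.cobounded ℂ, H z ^ P.natDegree = P.eval z) :
    ∃ t ∈ Bornology.cobounded ℂ, Set.InjOn H t := by
  refine exists_injOn_cobounded_of_isTheta hdiff ?_
  have hdeg : P.degree = (X ^ P.natDegree : ℂ[X]).degree := by
    rw [degree_X_pow, degree_eq_natDegree (ne_zero_of_natDegree_gt hP)]
  have hpow : (X ^ P.natDegree : ℂ[X]).eval = id ^ P.natDegree := by ext z; simp
  have hHP : H ^ P.natDegree =ᶠ[Bornology.cobounded ℂ] P.eval := hH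
  have hP1 := isBigO_cobounded_of_degree_le hdeg.le
  have hP2 := isBigO_cobounded_of_degree_le hdeg.ge
  rw [hpow] at hP1 hP2
  exact ⟨(hHP.trans_isBigO hP1).of_pow hP.ne', (hP2.trans_eventuallyEq hHP.symm).of_pow hP.ne'⟩

lemma deriv_eq_zero_iff_of_pow_eventuallyEq {𝕜 : Type*} [NontriviallyNormedField 𝕜] [CharZero 𝕜]
    {H g : 𝕜 → 𝕜} {w : 𝕜} {n : ℕ} (hn : n ≠ 0) (hH : DifferentiableAt 𝕜 H w)
    (hw : H w ≠ 0) (h : H ^ n =ᶠ[𝓝 w] g) : deriv H w = 0 ↔ deriv g w = 0 := by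
  rw [← h.deriv_eq, deriv_pow hH]
  simp [hn, hw]

lemma exists_exp_mul_of_dist_lt {s : Set ℂ} {x y : ℂ} (hs : ∀ z ∈ s, dist y x < dist z y) :
    ∃ L : ℂ → ℂ, DifferentiableOn ℂ L s ∧ ∀ z ∈ s, z - x = (z - y) * Complex.exp (L z) := by
  have hne : ∀ z ∈ s, z - y ≠ 0 := fun z hz ↦
    sub_ne_zero.2 (dist_pos.1 (dist_nonneg.trans_lt (hs z hz)))
  have hdiv : ∀ z ∈ s, (z - x) / (z - y) = 1 + (y - x) / (z - y) := fun z hz ↦ by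
    rw [one_add_div (hne z hz), sub_add_sub_cancel]
  have hslit : ∀ z ∈ s, (z - x) / (z - y) ∈ Complex.slitPlane := fun z hz ↦ by
    rw [hdiv z hz]
    refine Complex.mem_slitPlane_of_norm_lt_one ?_
    rw [norm_div, div_lt_one (norm_pos_iff.2 (hne z hz)), ← dist_eq_norm, ← dist_eq_norm]
    exact hs z hz
  refine ⟨fun z ↦ Complex.log ((z - x) / (z - y)), fun z hz ↦ ?_, fun z hz ↦ ?_⟩
  · refine DifferentiableWithinAt.clog (.div ?_ ?_ (hne z hz)) (hslit z hz) <;> fun_prop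
  · rw [Complex.exp_log (Complex.slitPlane_ne_zero (hslit z hz)), mul_div_cancel₀ _ (hne z hz)]

lemma exists_exp_mul_of_isPreconnected {K s : Set ℂ} (hK : IsPreconnected K)
    (hKs : ∀ x ∈ K, sᶜ ∈ 𝓝 x) {x y : ℂ} (hx : x ∈ K) (hy : y ∈ K) :
    ∃ L : ℂ → ℂ, DifferentiableOn ℂ L s ∧ ∀ z ∈ s, z - x = (z - y) * Complex.exp (L z) := by
  refine hK.induction₂ (fun x y ↦ ∃ L : ℂ → ℂ, DifferentiableOn ℂ L s ∧
    ∀ z ∈ s, z - x = (z - y) * Complex.exp (L z)) ?_ ?_ ?_ hx hy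
  · intro x hx
    obtain ⟨ε, hε, hball⟩ := Metric.mem_nhds_iff.1 (hKs x hx)
    filter_upwards [mem_nhdsWithin_of_mem_nhds (Metric.ball_mem_nhds x (half_pos hε))] with y hy
    refine exists_exp_mul_of_dist_lt fun z hz ↦ ?_
    have hzx : ε ≤ dist z x := not_lt.1 fun h ↦ hball h hz
    linarith [dist_triangle z y x, Metric.mem_ball.1 hy]
  · rintro x y w - - - ⟨L, hLd, hL⟩ ⟨M, hMd, hM⟩
    refine ⟨M + L, hMd.add hLd, fun z hz ↦ ?_⟩
    rw [hL z hz, hM z hz, Pi.add_apply, Complex.exp_add, mul_assoc]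
  · rintro x y - - ⟨L, hLd, hL⟩
    refine ⟨-L, hLd.neg, fun z hz ↦ ?_⟩
    rw [hL z hz, Pi.neg_apply, mul_assoc, ← Complex.exp_add, add_neg_cancel, Complex.exp_zero,
      mul_one]

lemma exists_prod_eq_pow_mul_exp_of_isPreconnected {K s : Set ℂ} (hK : IsPreconnected K)
    (hKs : ∀ x ∈ K, sᶜ ∈ 𝓝 x) {y : ℂ} (hy : y ∈ K) {m : Multiset ℂ} (hm : ∀ x ∈ m, x ∈ K) :
    ∃ L : ℂ → ℂ, DifferentiableOn ℂ L s ∧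
      ∀ z ∈ s, (m.map (z - ·)).prod = (z - y) ^ m.card * Complex.exp (L z) := by
  induction m using Multiset.induction_on with
  | empty => exact ⟨0, differentiableOn_const 0, by simp⟩
  | cons x m ih =>
    obtain ⟨L, hLd, hL⟩ := ih fun x hx ↦ hm x (Multiset.mem_cons_of_mem hx)
    obtain ⟨M, hMd, hM⟩ :=
      exists_exp_mul_of_isPreconnected hK hKs (hm x (Multiset.mem_cons_self x m)) hy
    refine ⟨M + L, hMd.add hLd, fun z hz ↦ ?_⟩
    rw [Multiset.map_cons, Multiset.prod_cons, hL z hz, hM z hz, Pi.add_apply, Complex.exp_add,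
      Multiset.card_cons]
    ring

theorem exists_pow_natDegree_eq_eval_of_isPreconnected {K s : Set ℂ} (hK : IsPreconnected K)
    (hKs : ∀ x ∈ K, sᶜ ∈ 𝓝 x) {P : ℂ[X]} (hP : 0 < P.natDegree) (hroots : ∀ x ∈ P.roots, x ∈ K) :
    ∃ H : ℂ → ℂ, DifferentiableOn ℂ H s ∧ ∀ z ∈ s, H z ^ P.natDegree = P.eval z := by
  have hsplits := IsAlgClosed.splits P
  obtain ⟨y, hy⟩ : ∃ y, y ∈ P.roots := by
    rwa [← Multiset.card_pos_iff_exists_mem, ← hsplits.natDegree_eq_card_roots]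
  obtain ⟨L, hLd, hL⟩ := exists_prod_eq_pow_mul_exp_of_isPreconnected hK hKs (hroots y hy) hroots
  obtain ⟨c, hc⟩ := IsAlgClosed.exists_pow_nat_eq P.leadingCoeff hP
  refine ⟨fun z ↦ c * ((z - y) * Complex.exp (L z / P.natDegree)), by fun_prop, fun z hz ↦ ?_⟩
  have hN : (P.natDegree : ℂ) ≠ 0 := Nat.cast_ne_zero.2 hP.ne'
  rw [mul_pow, mul_pow, hc, ← Complex.exp_nat_mul, mul_div_cancel₀ _ hN, hsplits.eval_eq_prod_roots,
    hL z hz, ← hsplits.natDegree_eq_card_roots]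

lemma not_eventually_eval_eq {P : ℂ[X]} (hP : 0 < P.natDegree) (z c : ℂ) :
    ¬ ∀ᶠ w in 𝓝 z, P.eval w = c := fun h ↦ by
  have hconst : P = C c := eq_of_infinite_eval_eq _ _ <| by
    simpa only [eval_C] using infinite_of_mem_nhds z h
  exact hP.ne' (hconst ▸ natDegree_C c)

lemma tendsto_eval_cobounded {P : ℂ[X]} (hP : 0 < P.natDegree) :
    Tendsto P.eval (Bornology.cobounded ℂ) (Bornology.cobounded ℂ) :=
  tendsto_norm_atTop_iff_cobounded.1
    (P.tendsto_norm_atTop (natDegree_pos_iff_degree_pos.1 hP) tendsto_norm_cobounded_atTop)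

lemma deriv_eq_zero_iff_isRoot_derivative_of_pow_eq_eval {P : ℂ[X]} {H : ℂ → ℂ} {s : Set ℂ}
    (hs : IsOpen s) (hH : DifferentiableOn ℂ H s) (hP : 0 < P.natDegree)
    (hpow : ∀ z ∈ s, H z ^ P.natDegree = P.eval z) {w : ℂ} (hw : w ∈ s) (hw0 : P.eval w ≠ 0) :
    deriv H w = 0 ↔ P.derivative.IsRoot w := by
  have hHw : H w ≠ 0 := by
    rintro h
    exact hw0 (by rw [← hpow w hw, h, zero_pow hP.ne'])
  rw [deriv_eq_zero_iff_of_pow_eventuallyEq hP.ne' (hH.differentiableAt (hs.mem_nhds hw)) hHw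
    ((hs.eventually_mem hw).mono hpow), Polynomial.deriv, IsRoot.def]

lemma eventually_cobounded_not_isRoot {R : Type*} [CommRing R] [IsDomain R] [Bornology R] {P : R[X]}
    (hP : P ≠ 0) : ∀ᶠ z in Bornology.cobounded R, ¬ P.IsRoot z :=
  Bornology.le_cofinite R (finite_setOfPred_isRoot hP).compl_mem_cofinite

lemma eventually_cobounded_forall_mem_of_eval_eq {P : ℂ[X]} (hP : 0 < P.natDegree) {t : Set ℂ}
    (ht : t ∈ Bornology.cobounded ℂ) :
    ∀ᶠ w in Bornology.cobounded ℂ, ∀ z, P.eval z = P.eval w → z ∈ t := by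
  have hbdd : Bornology.IsBounded (P.eval '' tᶜ) :=
    ((Bornology.isBounded_compl_iff.2 ht).isCompact_closure.image P.continuous).isBounded.subset
      (Set.image_mono subset_closure)
  filter_upwards [(tendsto_eval_cobounded hP).eventually hbdd.compl] with w hw z hzw
  by_contra hz
  exact hw ⟨z, hz, hzw⟩

lemma isBounded_doublePoints_of_pow_eq_eval {P : ℂ[X]} (hP : 0 < P.natDegree) {H : ℂ → ℂ}
    {s : Set ℂ} (hs : IsOpen s) (hs' : s ∈ Bornology.cobounded ℂ) (hH : DifferentiableOn ℂ H s)
    (hpow : ∀ z ∈ s, H z ^ P.natDegree = P.eval z) : Bornology.IsBounded (doublePoints H s) := by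
  obtain ⟨t, ht, hinj⟩ := exists_injOn_cobounded_of_pow_eq_eval hP
    (Eventually.mono hs' fun z hz ↦ hH.differentiableAt (hs.mem_nhds hz)) (Eventually.mono hs' hpow)
  have hP' : P.derivative ≠ 0 := derivative_ne_zero.2 hP.ne'
  rw [← Bornology.isCobounded_compl_iff]
  filter_upwards [eventually_cobounded_forall_mem_of_eval_eq hP ht,
    eventually_cobounded_not_isRoot (ne_zero_of_natDegree_gt hP),
    eventually_cobounded_not_isRoot hP'] with w hfibre hw hw'
  rintro ⟨hws, z, hzs, hwz⟩
  have hHzw : H z = H w := eq_of_dslope_eq_zero hwz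
  have hzt : z ∈ t := hfibre z (by rw [← hpow z hzs, hHzw, hpow w hws])
  obtain rfl : z = w := hinj hzt (hfibre w rfl) hHzw
  rw [dslope_same, deriv_eq_zero_iff_isRoot_derivative_of_pow_eq_eval hs hH hP hpow hws hw] at hwz
  exact hw' hwz

theorem not_isRoot_derivative_of_isPreconnected {P : ℂ[X]} (hP : 0 < P.natDegree) {K : Set ℂ}
    (hK : IsPreconnected K) (hroots : ∀ x ∈ P.roots, x ∈ K) {R : ℝ}
    (hKR : ∀ x ∈ K, ‖P.eval x‖ ≤ R) {ζ : ℂ} (hζ : R < ‖P.eval ζ‖) : ¬ P.derivative.IsRoot ζ := by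
  intro hcrit
  obtain ⟨r, hRr, hrζ⟩ := exists_between hζ
  let s : Set ℂ := {z | r < ‖P.eval z‖}
  have hs : IsOpen s := isOpen_lt continuous_const P.continuous.norm
  have hs' : s ∈ Bornology.cobounded ℂ :=
    (tendsto_norm_cobounded_atTop.comp (tendsto_eval_cobounded hP)).eventually_gt_atTop r
  have hKs : ∀ x ∈ K, sᶜ ∈ 𝓝 x := fun x hx ↦
    mem_of_superset ((isOpen_lt P.continuous.norm continuous_const).mem_nhds
      ((hKR x hx).trans_lt hRr)) fun _ (hz : _ < r) ↦ hz.not_gt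
  obtain ⟨H, hH, hpow⟩ := exists_pow_natDegree_eq_eval_of_isPreconnected hK hKs hP hroots
  have hfibre : ∀ z ∈ s, ∀ w ∈ s, H z = H w → P.eval z = P.eval w := fun z hz w hw h ↦ by
    rw [← hpow z hz, h, hpow w hw]
  have hconst : ∀ z ∈ s, ¬ ∀ᶠ z' in 𝓝 z, H z' = H z := fun z hz h ↦
    not_eventually_eval_eq hP z (P.eval z) <|
      ((hs.eventually_mem hz).and h).mono fun z' hz' ↦ hfibre z' hz'.1 z hz hz'.2
  have hproper : ∀ C ⊆ s, IsCompact C → ∃ D ⊆ s, IsCompact D ∧ ∀ z ∈ s, H z ∈ H '' C → z ∈ D := by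
    refine fun C hCs hC ↦ ⟨P.eval ⁻¹' (P.eval '' C), ?_,
      (P.isProperMap_eval (natDegree_pos_iff_degree_pos.1 hP)).isCompact_preimage
        (hC.image P.continuous), ?_⟩
    · rintro z ⟨w, hw, hwz⟩
      exact (hCs hw).trans_eq (congrArg norm hwz)
    · rintro z hz ⟨w, hw, hwz⟩
      exact ⟨w, hw, hfibre w (hCs hw) z hz hwz⟩
  have hempty : ∀ z ∈ s, z ∉ doublePoints H s := fun z hz hzd ↦
    (norm_le_of_closure_inter_subset P.differentiable (isOpen_doublePoints hs hH hconst)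
      (isBounded_doublePoints_of_pow_eq_eval hP hs hs' hH hpow)
      (closure_doublePoints_inter_subset hs hH hproper) hzd).not_gt hz
  have hζ0 : P.eval ζ ≠ 0 := fun h ↦
    hζ.not_ge (hKR ζ (hroots ζ (mem_roots'.2 ⟨ne_zero_of_natDegree_gt hP, h⟩)))
  refine hempty ζ hrζ ⟨hrζ, ζ, hrζ, ?_⟩
  rwa [dslope_same, deriv_eq_zero_iff_isRoot_derivative_of_pow_eq_eval hs hH hP hpow hrζ hζ0]

lemma eval_derivative_iterate_comp {R : Type*} [CommSemiring R] (f : R[X]) (n : ℕ) (z : R) :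
    (f.comp^[n] X).derivative.eval z = ∏ i ∈ Finset.range n, f.derivative.eval (f.eval^[i] z) := by
  induction n with
  | zero => simp
  | succ n ih =>
    rw [Function.iterate_succ_apply', derivative_comp, eval_mul, ih, eval_comp, iterate_comp_eval,
      eval_X, Finset.prod_range_succ]

lemma isRoot_derivative_iterate_comp_iff {R : Type*} [CommRing R] [IsDomain R] {f : R[X]} {n : ℕ}
    {z : R} :
    (f.comp^[n] X).derivative.IsRoot z ↔ ∃ i < n, f.derivative.IsRoot (f.eval^[i] z) := by
  simp only [IsRoot.def, eval_derivative_iterate_comp, Finset.prod_eq_zero_iff, Finset.mem_range]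

lemma mem_filledJulia_iff_exists_norm_le {g : ℂ → ℂ} {z : ℂ} :
    z ∈ filledJulia g ↔ ∃ B, ∀ m, ‖g^[m] z‖ ≤ B := by
  simp only [filledJulia, Set.mem_ofPred_eq, isBounded_iff_forall_norm_le, Set.forall_mem_range]

lemma apply_mem_filledJulia_iff {g : ℂ → ℂ} {z : ℂ} :
    g z ∈ filledJulia g ↔ z ∈ filledJulia g := by
  have hrange : {z} ∪ Set.range (fun m ↦ g^[m] (g z)) = Set.range fun m ↦ g^[m] z :=
    Nat.range_of_succ fun m ↦ g^[m] z
  simp only [filledJulia, Set.mem_ofPred_eq, ← hrange, Bornology.isBounded_union,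
    Bornology.isBounded_singleton, true_and]

lemma iterate_mem_filledJulia_iff {g : ℂ → ℂ} (n : ℕ) {z : ℂ} :
    g^[n] z ∈ filledJulia g ↔ z ∈ filledJulia g := by
  induction n with
  | zero => rfl
  | succ n ih => rw [Function.iterate_succ_apply', apply_mem_filledJulia_iff, ih]

/-- `R` is an escape radius of `g`: at distance at least `R` from the origin, `g` at least doubles
norms. Any factor greater than `1` would make the orbits outside the ball escape geometrically; `2`
is a normalization. -/
structure IsEscapeRadius {E : Type*} [Norm E] (g : E → E) (R : ℝ) : Prop where
  pos : 0 < R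
  two_mul_norm_le : ∀ z, R ≤ ‖z‖ → 2 * ‖z‖ ≤ ‖g z‖

namespace IsEscapeRadius

section Iterate

variable {E : Type*} [SeminormedAddGroup E] {g : E → E} {R : ℝ} {z : E}

lemma pow_mul_norm_le (hg : IsEscapeRadius g R) (hz : R ≤ ‖z‖) (m : ℕ) :
    2 ^ m * ‖z‖ ≤ ‖g^[m] z‖ := by
  induction m with
  | zero => simp
  | succ m ih =>
    have hle : ‖z‖ ≤ 2 ^ m * ‖z‖ := le_mul_of_one_le_left (norm_nonneg z) (one_le_pow₀ one_le_two)
    calc 2 ^ (m + 1) * ‖z‖ = 2 * (2 ^ m * ‖z‖) := by ring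
      _ ≤ 2 * ‖g^[m] z‖ := by gcongr
      _ ≤ ‖g^[m + 1] z‖ := by
        rw [Function.iterate_succ_apply']
        exact hg.two_mul_norm_le _ (hz.trans (hle.trans ih))

lemma tendsto_norm_iterate (hg : IsEscapeRadius g R) {m₀ : ℕ} (hz : R ≤ ‖g^[m₀] z‖) :
    Tendsto (fun m ↦ ‖g^[m] z‖) atTop atTop := by
  refine (tendsto_add_atTop_iff_nat m₀).1 (tendsto_atTop_mono (fun m ↦ ?_)
    ((tendsto_pow_atTop_atTop_of_one_lt one_lt_two).atTop_mul_const (hg.pos.trans_le hz)))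
  rw [Function.iterate_add_apply]
  exact hg.pow_mul_norm_le hz m

end Iterate

variable {g : ℂ → ℂ} {R : ℝ} {z : ℂ}

lemma notMem_filledJulia_iff (hg : IsEscapeRadius g R) :
    z ∉ filledJulia g ↔ ∃ m, R ≤ ‖g^[m] z‖ := by
  refine ⟨fun hz ↦ ?_, fun ⟨m, hm⟩ hz ↦ ?_⟩
  · by_contra! hlt
    exact hz (mem_filledJulia_iff_exists_norm_le.2 ⟨R, fun m ↦ (hlt m).le⟩)
  · obtain ⟨B, hB⟩ := mem_filledJulia_iff_exists_norm_le.1 hz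
    obtain ⟨q, hq⟩ := ((hg.tendsto_norm_iterate hm).eventually_gt_atTop B).exists
    exact hq.not_ge (hB q)

lemma tendsto_norm_iterate_of_notMem (hg : IsEscapeRadius g R) (hz : z ∉ filledJulia g) :
    Tendsto (fun m ↦ ‖g^[m] z‖) atTop atTop :=
  let ⟨_, hm⟩ := hg.notMem_filledJulia_iff.1 hz
  hg.tendsto_norm_iterate hm

lemma norm_lt_of_mem_filledJulia (hg : IsEscapeRadius g R) (hz : z ∈ filledJulia g) : ‖z‖ < R :=
  not_le.1 fun h ↦ hg.notMem_filledJulia_iff.2 ⟨0, h⟩ hz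

end IsEscapeRadius

lemma exists_isEscapeRadius_eval {R : Type*} [NormedField R] {G : R[X]} (hG : 2 ≤ G.natDegree) :
    ∃ r, IsEscapeRadius G.eval r := by
  have hdeg : (X : R[X]).degree < G.degree := by
    rw [degree_X, degree_eq_natDegree (ne_zero_of_natDegree_gt hG)]
    exact_mod_cast hG
  have hle := (isLittleO_cobounded_of_degree_lt hdeg).def (half_pos one_pos)
  obtain ⟨r, -, hr⟩ := (hasBasis_cobounded_norm.eventually_iff).1 hle
  refine ⟨max r 1, by positivity, fun z hz ↦ ?_⟩
  have hz' := hr (le_of_max_le_left hz)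
  rw [eval_X] at hz'
  linarith

theorem not_isConnected_filledJulia_of_isRoot_derivative {G : ℂ[X]} (hG : 2 ≤ G.natDegree) {ζ : ℂ}
    (hζ : G.derivative.IsRoot ζ) (hesc : ζ ∉ filledJulia G.eval) :
    ¬ IsConnected (filledJulia G.eval) := by
  rintro ⟨⟨p, hp⟩, hconn⟩
  obtain ⟨R, hR⟩ := exists_isEscapeRadius_eval hG
  obtain ⟨m, hm, hm1⟩ := (((hR.tendsto_norm_iterate_of_notMem hesc).eventually_gt_atTop
    (3 * R)).and (eventually_ge_atTop 1)).exists
  have hpR : ‖p‖ < R := hR.norm_lt_of_mem_filledJulia hp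
  let P : ℂ[X] := G.comp^[m] X - C p
  have hP_eval : ∀ z, P.eval z = G.eval^[m] z - p := fun z ↦ by
    rw [eval_sub, eval_C, iterate_comp_eval, eval_X]
  have hP_deg : 0 < P.natDegree := by
    rw [natDegree_sub_C, natDegree_iterate_comp, natDegree_X, mul_one]
    positivity
  have hP_crit : P.derivative.IsRoot ζ := by
    rw [derivative_sub, derivative_C, sub_zero]
    exact isRoot_derivative_iterate_comp_iff.2 ⟨0, hm1, hζ⟩
  have hP_roots : ∀ x ∈ P.roots, x ∈ filledJulia G.eval := fun x hx ↦ by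
    have hx0 : G.eval^[m] x = p := by rw [← sub_eq_zero, ← hP_eval, (mem_roots'.1 hx).2.eq_zero]
    rwa [← iterate_mem_filledJulia_iff m, hx0]
  have hP_le : ∀ x ∈ filledJulia G.eval, ‖P.eval x‖ ≤ 2 * R := fun x hx ↦ by
    have hxR := hR.norm_lt_of_mem_filledJulia ((iterate_mem_filledJulia_iff m).2 hx)
    rw [hP_eval]
    linarith [norm_sub_le (G.eval^[m] x) p]
  have hP_lt : 2 * R < ‖P.eval ζ‖ := by
    rw [hP_eval]
    linarith [norm_sub_norm_le (G.eval^[m] ζ) p]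
  exact not_isRoot_derivative_of_isPreconnected hP_deg hconn hP_roots hP_le hP_lt hP_crit

/-- The polynomial `φ⁻¹ ∘ fⁿ = a fⁿ + b`, whose evaluation map is `affineIterate f a b n`. -/
noncomputable def affineIteratePoly {R : Type*} [CommSemiring R] (f : R[X]) (a b : R) (n : ℕ) :
    R[X] :=
  C a * f.comp^[n] X + C b

lemma eval_affineIteratePoly (f : ℂ[X]) (a b : ℂ) (n : ℕ) :
    (affineIteratePoly f a b n).eval = affineIterate f a b n := by
  ext z
  simp [affineIteratePoly, affineIterate, iterate_comp_eval]

lemma natDegree_affineIteratePoly {R : Type*} [CommRing R] [IsDomain R] (f : R[X]) {a : R}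
    (ha : a ≠ 0) (b : R) (n : ℕ) :
    (affineIteratePoly f a b n).natDegree = f.natDegree ^ n := by
  rw [affineIteratePoly, natDegree_add_C, natDegree_C_mul ha, natDegree_iterate_comp,
    natDegree_X, mul_one]

lemma isRoot_derivative_affineIteratePoly {f : ℂ[X]} {n i : ℕ} {z : ℂ} (a b : ℂ) (hi : i < n)
    (hz : f.derivative.IsRoot (f.eval^[i] z)) :
    (affineIteratePoly f a b n).derivative.IsRoot z := by
  have hroot := isRoot_derivative_iterate_comp_iff.2 ⟨i, hi, hz⟩
  rw [affineIteratePoly, derivative_add, derivative_C, add_zero, derivative_C_mul, IsRoot.def,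
    eval_mul, hroot.eq_zero, mul_zero]

lemma affineIterate_iterate (f : ℂ[X]) (a b : ℂ) (m j : ℕ) (z : ℂ) :
    affineIterate f a b m (f.eval^[j] z) = affineIterate f a b (m + j) z := by
  rw [affineIterate, affineIterate, Function.iterate_add_apply]

lemma exists_isRoot_derivative_affineIteratePoly {f : ℂ[X]} (hf : f.natDegree ≠ 0) (a b : ℂ)
    {c : ℂ} (hc : f.derivative.IsRoot c) {k n : ℕ} (hk : 1 ≤ k) (hkn : k ≤ n) :
    ∃ ζ, (affineIteratePoly f a b n).derivative.IsRoot ζ ∧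
      affineIterate f a b n ζ = affineIterate f a b k c := by
  obtain ⟨ζ, hζ⟩ := (IsAlgClosed.eval_surjective hf).iterate (n - k) c
  refine ⟨ζ, isRoot_derivative_affineIteratePoly a b (Nat.sub_lt_self hk hkn) (hζ.symm ▸ hc), ?_⟩
  rw [← hζ, affineIterate_iterate, Nat.add_sub_cancel' hkn]

lemma eventually_isEscapeRadius_affineIterate {f : ℂ[X]} {R : ℝ} (hR : IsEscapeRadius f.eval R)
    {δ : ℝ} (hδ : 0 < δ) (B : ℝ) :
    ∀ᶠ n in atTop, ∀ a b, δ ≤ ‖a‖ → ‖b‖ ≤ B → IsEscapeRadius (affineIterate f a b n) R := by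
  have hlim : Tendsto (fun n : ℕ ↦ (2 : ℝ) ^ n * δ) atTop atTop :=
    (tendsto_pow_atTop_atTop_of_one_lt one_lt_two).atTop_mul_const hδ
  filter_upwards [hlim.eventually_ge_atTop (2 + B / R)] with n hn a b ha hb
  refine ⟨hR.pos, fun z hz ↦ ?_⟩
  have hbz : ‖b‖ ≤ B / R * ‖z‖ := by
    have hB : 0 ≤ B := (norm_nonneg b).trans hb
    calc ‖b‖ ≤ B / R * R := by rwa [div_mul_cancel₀ _ hR.pos.ne']
      _ ≤ B / R * ‖z‖ := by have := hR.pos.le; gcongr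
  have haz : (2 + B / R) * ‖z‖ ≤ ‖a * f.eval^[n] z‖ := by
    calc (2 + B / R) * ‖z‖ ≤ 2 ^ n * δ * ‖z‖ := by gcongr
      _ = δ * (2 ^ n * ‖z‖) := by ring
      _ ≤ ‖a‖ * ‖f.eval^[n] z‖ := by gcongr; exact hR.pow_mul_norm_le hz n
      _ = ‖a * f.eval^[n] z‖ := (norm_mul ..).symm
  calc 2 * ‖z‖ ≤ ‖a * f.eval^[n] z‖ - ‖b‖ := by linarith
    _ ≤ ‖a * f.eval^[n] z + b‖ := norm_sub_le_norm_add ..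

section Limit

variable {ι : Type*} {l : Filter ι} {f : ℂ[X]}

theorem eventually_notMem_filledJulia_affineIterate (hf : 2 ≤ f.natDegree) {n : ι → ℕ}
    (hn : Tendsto n l atTop) {a b x : ι → ℂ} {a₀ b₀ x₀ : ℂ} (ha₀ : a₀ ≠ 0)
    (ha : Tendsto a l (𝓝 a₀)) (hb : Tendsto b l (𝓝 b₀)) (hx : Tendsto x l (𝓝 x₀))
    (hx₀ : x₀ ∉ filledJulia f.eval) :
    ∀ᶠ i in l, x i ∉ filledJulia (affineIterate f (a i) (b i) (n i)) := by
  obtain ⟨R, hR⟩ := exists_isEscapeRadius_eval hf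
  obtain ⟨j, hj⟩ := ((hR.tendsto_norm_iterate_of_notMem hx₀).eventually_gt_atTop R).exists
  have hxj : ∀ᶠ i in l, R < ‖f.eval^[j] (x i)‖ :=
    (((f.continuous.iterate j).tendsto x₀).comp hx).norm.eventually_const_lt hj
  have hδ : 0 < ‖a₀‖ / 2 := half_pos (norm_pos_iff.2 ha₀)
  have hRn := eventually_isEscapeRadius_affineIterate hR hδ (‖b₀‖ + 1)
  filter_upwards [hxj, ha.norm.eventually_const_le (half_lt_self (norm_pos_iff.2 ha₀)),
    hb.norm.eventually_le_const (lt_add_one ‖b₀‖), hn.eventually hRn,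
    hn.eventually ((tendsto_sub_atTop_nat j).eventually hRn), hn.eventually_ge_atTop j]
    with i hxi hai hbi hRi hRij hji
  refine (hRi _ _ hai hbi).notMem_filledJulia_iff.2 ⟨1, ?_⟩
  have hdouble := (hRij _ _ hai hbi).two_mul_norm_le _ hxi.le
  rw [affineIterate_iterate, Nat.sub_add_cancel hji] at hdouble
  rw [Function.iterate_one]
  linarith [hR.pos]

theorem eventually_notMem_filledJulia_affineIterate_of_tendsto (hf : 2 ≤ f.natDegree) {n : ι → ℕ}
    (hn : Tendsto n l atTop) {u : ι → ℂ × ℂ} {a b : ℂ} (ha : a ≠ 0) (hu : Tendsto u l (𝓝 (a, b)))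
    {c : ℂ} {k : ℕ} (hk : affineIterate f a b k c ∉ filledJulia f.eval) :
    ∀ᶠ i in l, affineIterate f (u i).1 (u i).2 k c ∉
      filledJulia (affineIterate f (u i).1 (u i).2 (n i)) :=
  eventually_notMem_filledJulia_affineIterate hf hn ha hu.fst_nhds hu.snd_nhds
    ((hu.fst_nhds.mul_const _).add hu.snd_nhds) hk

theorem eventually_notMem_connectednessLocus (hf : 2 ≤ f.natDegree) {n : ι → ℕ}
    (hn : Tendsto n l atTop) {u : ι → ℂ × ℂ} {a b : ℂ} (ha : a ≠ 0) (hu : Tendsto u l (𝓝 (a, b)))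
    {c : ℂ} (hc : f.derivative.IsRoot c) {k : ℕ} (hk1 : 1 ≤ k)
    (hk : affineIterate f a b k c ∉ filledJulia f.eval) :
    ∀ᶠ i in l, u i ∉ connectednessLocus f (n i) := by
  filter_upwards [eventually_notMem_filledJulia_affineIterate_of_tendsto hf hn ha hu hk,
    hn.eventually_ge_atTop k] with i hesc hki
  rintro ⟨hu0, hconn⟩
  obtain ⟨ζ, hζ, hval⟩ := exists_isRoot_derivative_affineIteratePoly (by lia) (u i).1 (u i).2 hc
    hk1 hki
  rw [← hval, apply_mem_filledJulia_iff, ← eval_affineIteratePoly] at hesc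
  rw [← eval_affineIteratePoly] at hconn
  refine not_isConnected_filledJulia_of_isRoot_derivative ?_ hζ hesc hconn
  rw [natDegree_affineIteratePoly f hu0]
  exact hf.trans (Nat.le_self_pow (by lia) _)

end Limit

theorem mainTheorem12_general (f : ℂ[X]) (hdeg : 2 ≤ f.natDegree) (a b : ℂ) (ha : a ≠ 0)
    (c : ℂ) (hc : f.derivative.IsRoot c) (k : ℕ)
    (hk : affineIterate f a b k c ∉ filledJulia (fun z => f.eval z)) :
    (∃ N : ℕ, ∀ n : ℕ, N ≤ n →
      affineIterate f a b k c ∉ filledJulia (affineIterate f a b n)) ∧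
    (1 ≤ k → (a, b) ∉ setLiminf (connectednessLocus f)) := by
  refine ⟨eventually_atTop.1 <| eventually_notMem_filledJulia_affineIterate hdeg tendsto_id ha
    tendsto_const_nhds tendsto_const_nhds tendsto_const_nhds hk, fun hk1 ⟨u, hmem, hu⟩ ↦ ?_⟩
  obtain ⟨n, hn, hn'⟩ :=
    (hmem.and (eventually_notMem_connectednessLocus hdeg tendsto_id ha hu hc hk1 hk)).exists
  exact hn' hn

theorem mainTheorem12 (f : ℂ[X]) (hdeg : 2 ≤ f.natDegree) (hmonic : f.Monic)
    (hcent : IsCentered f) (a b : ℂ) (ha : a ≠ 0)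
    (c : ℂ) (hc : f.derivative.IsRoot c) (k : ℕ)
    (hk : affineIterate f a b k c ∉ filledJulia (fun z => f.eval z)) :
    (∃ N : ℕ, ∀ n : ℕ, N ≤ n →
      affineIterate f a b k c ∉ filledJulia (affineIterate f a b n)) ∧
    (1 ≤ k → (a, b) ∉ setLiminf (connectednessLocus f)) :=
  mainTheorem12_general f hdeg a b ha c hc k hk
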